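/- All graphs are finite and simple, and graphs are considered up to isomorphism. For a graph $G$ let $\nu(G)$ be the maximum number of edges of a matching of $G$, and let $\mathrm{def}(G)=|V(G)|-2\nu(G)$ be its deficiency. For a family $\mathcal H$ of graphs, $G$ is $\mathcal H$-free if no member of $\mathcal H$ is isomorphic to an induced subgraph of $G$. For an integer $d\ge 3$, let $\mathcal B_d$ be the collection of all families $\mathcal H$ of connected graphs such that $\mathrm{def}(G)<d$ for every connected $\mathcal H$-free graph $G$, and let $\mathcal B'_d$ be the collection of the inclusion-minimal members of $\mathcal B_d$, that is, those $\mathcal H\in\mathcal B_d$ such that $\mathcal H'\notin\mathcal B_d$ for every proper subset $\mathcal H'\subset\mathcal H$. Let $K_{1,s}$ be the star with $s$ leaves, let $P_n$ be the path on $n$ vertices, and let $T_3$ be the graph obtained from $P_3$ by adding two new vertices, each joined by a single edge to the same end of $P_3$. Theorem. Let $d\ge 3$ be an integer and let $\mathcal H=\{H_1,H_2\}$, where $H_1$ and $H_2$ are non-isomorphic graphs. Then $\mathcal H\in\mathcal B'_d$ if and only if $\mathcal H=\{K_{1,s},T_3\}$ or $\mathcal H=\{K_{1,s},P_4\}$ for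 some integer $s$ with $4\le s\le d+1$. -/

import Mathlib

/-- A finite simple graph, bundled with its vertex set. -/
structure FinGraph where
  /-- the vertex set -/
  V : Type
  [finite : Finite V]
  /-- the graph on that vertex set -/
  graph : SimpleGraph V

attribute [instance] FinGraph.finite

namespace FinGraph

/-- Isomorphism of finite graphs. -/
def Iso (G H : FinGraph) : Prop := Nonempty (G.graph ≃g H.graph)

/-- `H ≺ G`: some induced subgraph of `G` is isomorphic to `H`. -/
def IsInducedIn (H G : FinGraph) : Prop := H.graph.IsIndContained G.graph

/-- `G` is `𝓗`-free: no member of `𝓗` is isomorphic to an induced subgraph of `G`. -/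
def IsFree (𝓗 : Set FinGraph) (G : FinGraph) : Prop := ∀ H ∈ 𝓗, ¬ H.IsInducedIn G

/-- The matching number: the largest number of edges of a matching of `G`
(a maximum of a finite nonempty set, since `G` is finite). -/
noncomputable def matchingNumber (G : FinGraph) : ℕ :=
  sSup {k : ℕ | ∃ M : G.graph.Subgraph, M.IsMatching ∧ M.edgeSet.ncard = k}

/-- The deficiency `|V(G)| - 2 ν(G)`, where `ν` is the matching number. -/
noncomputable def deficiency (G : FinGraph) : ℤ :=
  (Nat.card G.V : ℤ) - 2 * (G.matchingNumber : ℤ)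

/-- `𝓗` consists of connected graphs, and every connected `𝓗`-free graph has deficiency less
than `d`. -/
def BoundsDeficiency (d : ℕ) (𝓗 : Set FinGraph) : Prop :=
  (∀ H ∈ 𝓗, H.graph.Connected) ∧
    ∀ G : FinGraph, G.graph.Connected → IsFree 𝓗 G → G.deficiency < (d : ℤ)

/-- `𝓗` bounds the deficiency by `d`, and no proper subfamily of `𝓗` does. -/
def MinimallyBoundsDeficiency (d : ℕ) (𝓗 : Set FinGraph) : Prop :=
  BoundsDeficiency d 𝓗 ∧ ∀ 𝓗' : Set FinGraph, 𝓗' ⊂ 𝓗 → ¬ BoundsDeficiency d 𝓗'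

/-- Two families of graphs are equal up to isomorphism of their members. -/
def SameFamily (𝓗 𝓗' : Set FinGraph) : Prop :=
  (∀ H ∈ 𝓗, ∃ H' ∈ 𝓗', H.Iso H') ∧ (∀ H' ∈ 𝓗', ∃ H ∈ 𝓗, H.Iso H')

/-- The star `K_{1,s}`. -/
def star (s : ℕ) : FinGraph where
  V := Fin 1 ⊕ Fin s
  graph := completeBipartiteGraph (Fin 1) (Fin s)

/-- The path `P_n` on `n` vertices. -/
def path (n : ℕ) : FinGraph where
  V := Fin n
  graph := SimpleGraph.pathGraph n

/-- The graph `T_n` (for `n ≥ 1`): the path `P_n` on `Fin n` together with two new leaves, both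
joined to the end `0` of the path. -/
def tee (n : ℕ) : FinGraph where
  V := Fin n ⊕ Fin 2
  graph :=
    { Adj := fun x y =>
        match x, y with
        | .inl a, .inl b => (SimpleGraph.pathGraph n).Adj a b
        | .inl a, .inr _ => a.val = 0
        | .inr _, .inl b => b.val = 0
        | .inr _, .inr _ => False
      symm := by
        constructor
        rintro (a | a) (b | b) h
        · exact SimpleGraph.Adj.symm h
        · exact h
        · exact h
        · exact h
      loopless := by
        constructor
        rintro (a | a) h
        · exact SimpleGraph.irrefl _ h
        · exact h }

end FinGraph

/-! Sufficiency rests on `deficiency_lt_of_not_isIndContained`: a connected graph without induced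
`K_{1,d+1}` and `T_3` has deficiency below `d`. If the deficiency were `D ≥ d`, Tutte–Berge
(`exists_barrier`) would give a set `S` whose removal leaves at least `|S| + D` odd components, and
by `exists_barrier_three_le` every `s ∈ S` may be assumed to touch at least three components. Let
`N(s)` be the set of components touched by `s`. Star-freeness gives `|N(s)| ≤ d`. Excluding `T_3`
gives `|N(t) \ N(s)| ≤ 1` or `N(s) ⊆ N(t)` whenever `N(s)` and `N(t)` meet
(`ncard_diff_le_one_or_subset`), and makes the intersection graph of the `N(s)` connected. Starting
from a largest `N(s₀)`, each further vertex then contributes at most one new component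
(`ncard_iUnion_lt_of_intersectionGraph_connected`), so there are at most `d + |S| - 1` components: a
contradiction.

Necessity uses three connected graphs of deficiency at least `d`: `K_{1,d+1}`, `caterpillar d` and
`pendantClique d`. The first forces one member `H₁` of the family to be an induced subgraph of a
star. Were it inside `K_{1,3}`, hence also inside `T_3`, the family `{H₁}` would already suffice; so
it is `K_{1,s}` with `s ≥ 4`. The other two graphs have no induced `K_{1,4}`, so both contain `H₂`;
this puts `H₂` inside `T_3` (`isInducedIn_tee`), and the only connected induced subgraphs of `T_3`
outside `K_{1,3}` are `T_3` and `P_4`. -/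

namespace SimpleGraph

/-- The spanning subgraph of `G` in which every edge meeting `S` has been deleted. -/
def isolate {V : Type*} (G : SimpleGraph V) (S : Set V) : SimpleGraph V where
  Adj a b := G.Adj a b ∧ a ∉ S ∧ b ∉ S
  symm := ⟨fun _ _ h => ⟨h.1.symm, h.2.2, h.2.1⟩⟩
  loopless := ⟨fun _ h => G.irrefl h.1⟩

/-! ### Components under an embedding whose image is a union of components. -/

section Components

variable {V W : Type*} {K : SimpleGraph V} {H : SimpleGraph W}

theorem supp_map_of_closed_range (φ : K ↪g H)
    (hφ : ∀ a y, H.Adj (φ a) y → y ∈ Set.range φ) (c : K.ConnectedComponent) :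
    (c.map φ.toHom).supp = φ '' c.supp := by
  induction c using ConnectedComponent.ind with
  | h v =>
    ext y
    simp only [ConnectedComponent.map_mk, ConnectedComponent.mem_supp_iff, ConnectedComponent.eq,
      Set.mem_image]
    constructor
    · intro h
      have h' := h.symm
      rw [reachable_iff_reflTransGen] at h'
      clear h
      induction h' with
      | refl => exact ⟨v, Reachable.refl _, rfl⟩
      | tail _ hbc ih =>
        obtain ⟨x, hx, rfl⟩ := ih
        obtain ⟨z, rfl⟩ := hφ x _ hbc
        exact ⟨z, ((φ.map_adj_iff.1 hbc).symm.reachable).trans hx, rfl⟩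
    · rintro ⟨x, hx, rfl⟩
      exact hx.map φ.toHom

theorem map_injective_of_closed_range (φ : K ↪g H)
    (hφ : ∀ a y, H.Adj (φ a) y → y ∈ Set.range φ) :
    Function.Injective (ConnectedComponent.map φ.toHom) := by
  intro c c' h
  apply ConnectedComponent.supp_injective
  apply φ.injective.image_injective
  simp only [← supp_map_of_closed_range φ hφ, h]

theorem map_mem_oddComponents_iff (φ : K ↪g H)
    (hφ : ∀ a y, H.Adj (φ a) y → y ∈ Set.range φ) (c : K.ConnectedComponent) :
    c.map φ.toHom ∈ H.oddComponents ↔ c ∈ K.oddComponents := by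
  simp only [Set.mem_ofPred_eq, supp_map_of_closed_range φ hφ,
    Set.ncard_image_of_injective _ φ.injective]

theorem ncard_oddComponents_le_of_closed_range [Finite V] [Finite W] (φ : K ↪g H)
    (hφ : ∀ a y, H.Adj (φ a) y → y ∈ Set.range φ) :
    H.oddComponents.ncard ≤ K.oddComponents.ncard + (Set.range φ)ᶜ.ncard := by
  have hsub : H.oddComponents ⊆ ConnectedComponent.map φ.toHom '' K.oddComponents ∪
      H.connectedComponentMk '' (Set.range φ)ᶜ := by
    intro c hc
    induction c using ConnectedComponent.ind with
    | h v =>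
      by_cases hv : v ∈ Set.range φ
      · obtain ⟨x, rfl⟩ := hv
        exact Or.inl ⟨K.connectedComponentMk x, (map_mem_oddComponents_iff φ hφ _).1 hc, rfl⟩
      · exact Or.inr ⟨v, hv, rfl⟩
  refine (Set.ncard_le_ncard hsub).trans ((Set.ncard_union_le _ _).trans ?_)
  exact Nat.add_le_add (Set.ncard_image_le (Set.toFinite _)) (Set.ncard_image_le (Set.toFinite _))

end Components

/-! ### Deleting a vertex set while keeping its vertices as isolated points. -/

section Isolate

variable {V : Type*} {G : SimpleGraph V} {S : Set V}

theorem isolate_reachable_iff_of_mem {s x : V} (hs : s ∈ S) :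
    (G.isolate S).Reachable s x ↔ s = x := by
  refine ⟨fun h => ?_, fun h => h ▸ Reachable.refl _⟩
  rw [reachable_iff_reflTransGen] at h
  rcases h.cases_head with h | ⟨y, hy, -⟩
  · exact h
  · exact absurd hs hy.2.1

theorem isolate_supp_of_mem {s : V} (hs : s ∈ S) :
    ((G.isolate S).connectedComponentMk s).supp = {s} := by
  ext x
  rw [ConnectedComponent.mem_supp_iff, ConnectedComponent.eq, reachable_comm,
    isolate_reachable_iff_of_mem hs, Set.mem_singleton_iff, eq_comm]

/-- Each vertex of `S` is an odd component of `G.isolate S`, so this graph has `|S|` more odd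
components than `G - S`. This is the origin of the factor 2 in every barrier inequality below. -/
theorem IsTutteViolator.lt_ncard_oddComponents_isolate [Finite V] (h : G.IsTutteViolator S) :
    2 * S.ncard < (G.isolate S).oddComponents.ncard := by
  let K := ((⊤ : G.Subgraph).deleteVerts S).coe
  have hK : ∀ a : ((⊤ : G.Subgraph).deleteVerts S).verts, a.1 ∉ S := fun a => a.2.2
  let φ : K ↪g G.isolate S :=
    { toFun := Subtype.val
      inj' := Subtype.val_injective
      map_rel_iff' := by
        intro a b
        have ha := hK a
        have hb := hK b
        simp [K, isolate, ha, hb] }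
  have hφ : ∀ a y, (G.isolate S).Adj (φ a) y → y ∈ Set.range φ := by
    intro a y hy
    exact ⟨⟨y, by simpa using hy.2.2⟩, rfl⟩
  have hsub : ConnectedComponent.map φ.toHom '' K.oddComponents ∪
      (G.isolate S).connectedComponentMk '' S ⊆ (G.isolate S).oddComponents := by
    rintro c (⟨c, hc, rfl⟩ | ⟨s, hs, rfl⟩)
    · exact (map_mem_oddComponents_iff φ hφ _).2 hc
    · simp [isolate_supp_of_mem hs]
  have hdisj : Disjoint (ConnectedComponent.map φ.toHom '' K.oddComponents)
      ((G.isolate S).connectedComponentMk '' S) := by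
    rw [Set.disjoint_left]
    rintro _ ⟨c, hc, rfl⟩ ⟨s, hs, hsc⟩
    have h1 := supp_map_of_closed_range φ hφ c
    rw [← hsc, isolate_supp_of_mem hs] at h1
    obtain ⟨x, -, hx⟩ := h1.le (Set.mem_singleton s)
    exact hK x (by rwa [show (x : V) = s from hx])
  have hinj : Set.InjOn (G.isolate S).connectedComponentMk S := by
    intro s hs t _ hst
    exact (isolate_reachable_iff_of_mem hs).1 (ConnectedComponent.exact hst)
  have hle := Set.ncard_le_ncard hsub
  rw [Set.ncard_union_eq hdisj, Set.ncard_image_of_injective _ (map_injective_of_closed_range φ hφ),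
    hinj.ncard_image] at hle
  have h' : S.ncard < K.oddComponents.ncard := h
  omega

end Isolate

/-! ### The Tutte–Berge formula, from Tutte's theorem for the join with a clique. -/

section Join

variable {V : Type*}

/-- The graph obtained from `G` by adding the vertices of `U`, each joined to all other vertices. -/
def addUniversal (G : SimpleGraph V) (U : Type*) : SimpleGraph (V ⊕ U) where
  Adj x y := x ≠ y ∧ ∀ a b, x = .inl a → y = .inl b → G.Adj a b
  symm := ⟨fun _ _ h => ⟨h.1.symm, fun a b ha hb => (h.2 b a hb ha).symm⟩⟩
  loopless := ⟨fun _ h => h.1 rfl⟩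

theorem addUniversal_adj_inl {G : SimpleGraph V} {U : Type*} {a b : V} :
    (G.addUniversal U).Adj (.inl a) (.inl b) ↔ G.Adj a b := by
  constructor
  · exact fun h => h.2 a b rfl rfl
  · intro h
    refine ⟨fun hab => h.ne (Sum.inl_injective hab), ?_⟩
    rintro _ _ ⟨⟩ ⟨⟩
    exact h

theorem exists_isMatching_of_addUniversal [Finite V] {G : SimpleGraph V} {U : Type*} [Finite U]
    {M : (G.addUniversal U).Subgraph} (hM : M.IsPerfectMatching) :
    ∃ N : G.Subgraph, N.IsMatching ∧ Nat.card V ≤ N.verts.ncard + Nat.card U := by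
  let N : G.Subgraph :=
    { verts := {v | ∃ w, M.Adj (.inl v) (.inl w)}
      Adj := fun v w => M.Adj (.inl v) (.inl w)
      adj_sub := fun h => addUniversal_adj_inl.1 h.adj_sub
      edge_vert := fun h => ⟨_, h⟩
      symm := ⟨fun _ _ h => h.symm⟩ }
  rw [Subgraph.isPerfectMatching_iff] at hM
  refine ⟨N, ?_, ?_⟩
  · rintro v ⟨w, hw⟩
    exact ⟨w, hw, fun y hy => Sum.inl_injective ((hM _).unique hy hw)⟩
  · have hc : N.vertsᶜ.ncard ≤ Nat.card U := by
      have hx : ∀ v : (N.vertsᶜ : Set V), ∃ u : U, M.Adj (.inl v.1) (.inr u) := by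
        rintro ⟨v, hv⟩
        obtain ⟨w | u, hw, -⟩ := hM (.inl v)
        · exact absurd ⟨w, hw⟩ hv
        · exact ⟨u, hw⟩
      choose f hf using hx
      rw [← Nat.card_coe_set_eq]
      refine Nat.card_le_card_of_injective f fun a b hab => ?_
      have := (hM (.inr (f a))).unique (hf a).symm (hab ▸ (hf b).symm)
      exact Subtype.ext (Sum.inl_injective this)
    have := Set.ncard_add_ncard_compl N.verts
    omega

/-- The hard direction of the Tutte–Berge formula: if every matching misses more than `k` vertices
and the parities agree, then there is a barrier of excess at least `k + 2`. -/
theorem exists_barrier [Finite V] (G : SimpleGraph V) (k : ℕ) (hk : Even (Nat.card V + k))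
    (h : ∀ M : G.Subgraph, M.IsMatching → M.verts.ncard + k < Nat.card V) :
    ∃ S : Set V, 2 * S.ncard + k + 2 ≤ (G.isolate S).oddComponents.ncard := by
  let G' := G.addUniversal (Fin k)
  have hno : ¬ ∃ M : G'.Subgraph, M.IsPerfectMatching := by
    rintro ⟨M, hM⟩
    obtain ⟨N, hN, hle⟩ := exists_isMatching_of_addUniversal hM
    have := h N hN
    simp at hle
    omega
  rw [tutte] at hno
  push Not at hno
  obtain ⟨S', hS'⟩ := hno
  have h1 := hS'.lt_ncard_oddComponents_isolate
  -- The number of odd components has the parity of the number of vertices, here even, so the strict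
  -- Tutte inequality improves to an excess of 2.
  have hpar : Even (G'.isolate S').oddComponents.ncard := by
    rw [← Nat.not_odd_iff_even, odd_ncard_oddComponents, Nat.not_odd_iff_even]
    simpa using hk
  have h2 : 2 * S'.ncard + 2 ≤ (G'.isolate S').oddComponents.ncard := by
    obtain ⟨m, hm⟩ := hpar
    omega
  -- If `S'` contains all `k` new vertices, removing them from `S'` lowers `2|S'|` by `2k` and the
  -- number of odd components by at most `k`, which leaves excess `k + 2`.
  by_cases hu : ∀ u, Sum.inr u ∈ S'
  · let S : Set V := Sum.inl ⁻¹' S'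
    have hcard : S'.ncard = S.ncard + k := by
      have : S' = Sum.inl '' S ∪ Sum.inr '' (Set.univ : Set (Fin k)) := by
        ext (x | x) <;> simp [S, hu]
      rw [this, Set.ncard_union_eq, Set.ncard_image_of_injective _ Sum.inl_injective,
        Set.ncard_image_of_injective _ Sum.inr_injective]
      · simp
      · rw [Set.disjoint_left]
        rintro _ ⟨a, -, rfl⟩ ⟨b, -, hb⟩
        cases hb
    let φ : G.isolate S ↪g G'.isolate S' :=
      { toFun := Sum.inl
        inj' := Sum.inl_injective
        map_rel_iff' := by
          intro a b
          simp [isolate, S, G', addUniversal_adj_inl] }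
    have hrange : (Set.range φ)ᶜ = Sum.inr '' (Set.univ : Set (Fin k)) := by
      ext (x | x) <;> simp [φ]
    have hle := ncard_oddComponents_le_of_closed_range φ (by
      rintro a (y | y) hy
      · exact ⟨y, rfl⟩
      · exact absurd (hu y) hy.2.2)
    rw [hrange, Set.ncard_image_of_injective _ Sum.inr_injective] at hle
    simp at hle
    refine ⟨S, ?_⟩
    simp only [oddComponents] at *
    omega
  -- A new vertex outside `S'` is joined to everything else outside `S'`, so there are at most `|S'|
  -- + 1` components, too few for a violator.
  · push Not at hu
    obtain ⟨u, hu⟩ := hu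
    have hsub : (G'.isolate S').oddComponents ⊆
        (G'.isolate S').connectedComponentMk '' (insert (Sum.inr u) S') := by
      intro c _
      induction c using ConnectedComponent.ind with
      | h v =>
        by_cases hv : v ∈ S'
        · exact ⟨v, Or.inr hv, rfl⟩
        · refine ⟨Sum.inr u, Or.inl rfl, ?_⟩
          by_cases hvu : v = Sum.inr u
          · rw [hvu]
          · refine ConnectedComponent.sound (Adj.reachable ⟨⟨Ne.symm hvu, ?_⟩, hu, hv⟩)
            intro a b ha
            cases ha
    have hle := (Set.ncard_le_ncard hsub).trans (Set.ncard_image_le (Set.toFinite _))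
    have := Set.ncard_insert_le (Sum.inr u) S'
    omega

end Join

end SimpleGraph

open SimpleGraph

/-! ### The union of a connected set system with nearly nested neighbours. -/

section SetSystem

variable {ι C : Type*}

/-- The intersection graph of a family of sets. -/
def intersectionGraph (N : ι → Set C) : SimpleGraph ι where
  Adj s t := s ≠ t ∧ (N s ∩ N t).Nonempty
  symm := ⟨fun s t h => ⟨h.1.symm, by rw [Set.inter_comm]; exact h.2⟩⟩
  loopless := ⟨fun _ h => h.1 rfl⟩

/-- Take for `t` the second vertex of a shortest path from `s` to `s₀`. The bad case is `N t ⊆ N s`.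
If `t = s₀`, maximality forces equality; otherwise the third vertex `u` meets `N t`, hence `N s`,
and the path could be shortened. -/
theorem exists_closer_of_intersectionGraph_connected [Finite C] {N : ι → Set C}
    (hconn : (intersectionGraph N).Connected)
    (hN : ∀ s t, (intersectionGraph N).Adj s t → (N t \ N s).ncard ≤ 1 ∨ N s ⊆ N t)
    {s₀ : ι} (hs₀ : ∀ s, (N s).ncard ≤ (N s₀).ncard) {s : ι} (hs : s ≠ s₀) :
    ∃ t, (intersectionGraph N).dist t s₀ < (intersectionGraph N).dist s s₀ ∧
      (N s \ N t).ncard ≤ 1 := by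
  obtain ⟨p, hp⟩ := hconn.exists_walk_length_eq_dist s s₀
  cases p with
  | nil => exact absurd rfl hs
  | @cons _ t _ hst q =>
    have hq := dist_le q
    rw [Walk.length_cons] at hp
    refine ⟨t, by omega, ?_⟩
    rcases hN t s hst.symm with h | h
    · exact h
    cases q with
    | nil => simp [Set.eq_of_subset_of_ncard_le h (hs₀ s)]
    | @cons _ u _ htu r =>
      exfalso
      have hr := dist_le r
      rw [Walk.length_cons] at hp hq
      obtain ⟨c, hct, hcu⟩ := htu.2
      by_cases hus : s = u
      · subst hus
        omega
      · have hadj : (intersectionGraph N).Adj s u := ⟨hus, c, h hct, hcu⟩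
        have := dist_le (Walk.cons hadj r)
        rw [Walk.length_cons] at this
        omega

theorem ncard_iUnion_lt_of_intersectionGraph_connected [Finite ι] [Finite C] {N : ι → Set C}
    (hconn : (intersectionGraph N).Connected)
    (hN : ∀ s t, (intersectionGraph N).Adj s t → (N t \ N s).ncard ≤ 1 ∨ N s ⊆ N t)
    {d : ℕ} (hd : ∀ s, (N s).ncard ≤ d) :
    (⋃ s, N s).ncard + 1 ≤ d + Nat.card ι := by
  have := hconn.nonempty
  obtain ⟨s₀, hs₀⟩ := Finite.exists_max fun s => (N s).ncard
  choose p hpdist hp using fun s : {s // s ≠ s₀} =>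
    exists_closer_of_intersectionGraph_connected hconn hN hs₀ s.2
  -- Follow `p` towards `s₀` until `c` is lost. Each step loses at most one element, so distinct
  -- elements outside `N s₀` are charged to distinct indices other than `s₀`.
  have hcover : ∀ n s, (intersectionGraph N).dist s s₀ = n → ∀ c ∈ N s, c ∉ N s₀ →
      ∃ t : {s // s ≠ s₀}, c ∈ N t \ N (p t) := by
    intro n
    induction n using Nat.strong_induction_on with
    | _ n ih =>
      intro s hs c hc hc₀
      have hne : s ≠ s₀ := fun h => hc₀ (h ▸ hc)
      by_cases hcp : c ∈ N (p ⟨s, hne⟩)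
      · exact ih _ (hs ▸ hpdist ⟨s, hne⟩) _ rfl c hcp hc₀
      · exact ⟨⟨s, hne⟩, hc, hcp⟩
  have hcover' : ∀ c : ((⋃ s, N s) \ N s₀ : Set C), ∃ t : {s // s ≠ s₀}, c.1 ∈ N t \ N (p t) := by
    rintro ⟨c, hc, hc₀⟩
    obtain ⟨s, hs⟩ := Set.mem_iUnion.1 hc
    exact hcover _ s rfl c hs hc₀
  choose f hf using hcover'
  have hinj : Function.Injective f := by
    intro a b hab
    have hb := hf b
    rw [← hab] at hb
    exact Subtype.ext ((Set.ncard_le_one (Set.toFinite _)).1 (hp (f a)) _ (hf a) _ hb)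
  have h1 := Nat.card_le_card_of_injective f hinj
  have h2 : Nat.card {s // s ≠ s₀} + 1 = Nat.card ι := by
    have := Set.ncard_add_ncard_compl ({s₀} : Set ι)
    rw [Set.ncard_singleton] at this
    have h3 : Nat.card {s // s ≠ s₀} = ({s₀}ᶜ : Set ι).ncard := Nat.card_coe_set_eq _
    omega
  rw [Nat.card_coe_set_eq] at h1
  have h3 := Set.ncard_sdiff_add_ncard_of_subset (Set.subset_iUnion N s₀)
  have := hd s₀
  omega

end SetSystem

/-! ### Minimal barriers. -/

namespace SimpleGraph

variable {V : Type*} {G : SimpleGraph V} {S : Set V}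

/-- The components of `G - S` that contain a neighbour of `s`. -/
def adjacentComponents (G : SimpleGraph V) (S : Set V) (s : V) :
    Set (G.isolate S).ConnectedComponent :=
  {c | ∃ x, x ∉ S ∧ G.Adj s x ∧ (G.isolate S).connectedComponentMk x = c}

theorem mk_eq_of_adj {x y : V} (hx : x ∉ S) (hy : y ∉ S) (h : G.Adj x y) :
    (G.isolate S).connectedComponentMk x = (G.isolate S).connectedComponentMk y :=
  ConnectedComponent.sound (Adj.reachable ⟨h, hx, hy⟩)

theorem mk_mem_adjacentComponents {s x : V} (hx : x ∉ S) (h : G.Adj s x) :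
    (G.isolate S).connectedComponentMk x ∈ G.adjacentComponents S s :=
  ⟨x, hx, h, rfl⟩

theorem isolate_diff_singleton_supp_eq {s v : V} (hs : s ∈ S) (hv : v ≠ s)
    (hN : (G.isolate S).connectedComponentMk v ∉ G.adjacentComponents S s) :
    ((G.isolate (S \ {s})).connectedComponentMk v).supp =
      ((G.isolate S).connectedComponentMk v).supp := by
  have hle : G.isolate S ≤ G.isolate (S \ {s}) :=
    fun a b h => ⟨h.1, fun h' => h.2.1 h'.1, fun h' => h.2.2 h'.1⟩
  ext x
  simp only [ConnectedComponent.mem_supp_iff, ConnectedComponent.eq]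
  refine ⟨fun h => ?_, fun h => h.mono hle⟩
  have h' := h.symm
  rw [reachable_iff_reflTransGen] at h'
  clear h
  induction h' with
  | refl => exact Reachable.refl _
  | @tail a b _ hab ih =>
    have has : a ≠ s := by
      rintro rfl
      exact hv ((isolate_reachable_iff_of_mem hs).1 ih).symm
    have haS : a ∉ S := fun h => hab.2.1 ⟨h, has⟩
    have hbs : b ≠ s := by
      rintro rfl
      exact hN ⟨a, haS, hab.1.symm, ConnectedComponent.sound ih⟩
    exact (Adj.reachable (⟨hab.1.symm, fun h => hab.2.2 ⟨h, hbs⟩, haS⟩ :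
      (G.isolate S).Adj b a)).trans ih

/-- Returning `s` to the graph merges it with the components it touches; all other components
survive. The `1` accounts for the component `{s}`. -/
theorem ncard_oddComponents_isolate_le [Finite V] {s : V} (hs : s ∈ S) :
    (G.isolate S).oddComponents.ncard ≤
      (G.isolate (S \ {s})).oddComponents.ncard + 1 + (G.adjacentComponents S s).ncard := by
  have hsub : ConnectedComponent.supp '' (G.isolate S).oddComponents ⊆
      (ConnectedComponent.supp '' (G.isolate (S \ {s})).oddComponents ∪ {{s}}) ∪
        ConnectedComponent.supp '' G.adjacentComponents S s := by
    rintro _ ⟨c, hc, rfl⟩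
    by_cases hN : c ∈ G.adjacentComponents S s
    · exact Or.inr ⟨c, hN, rfl⟩
    refine Or.inl ?_
    induction c using ConnectedComponent.ind with
    | h v =>
      by_cases hv : v = s
      · subst hv
        exact Or.inr (isolate_supp_of_mem hs)
      · have := isolate_diff_singleton_supp_eq hs hv hN
        exact Or.inl ⟨_, by rwa [Set.mem_ofPred_eq, this], this⟩
  have h := (Set.ncard_le_ncard hsub).trans ((Set.ncard_union_le _ _).trans
    (Nat.add_le_add_right (Set.ncard_union_le _ _) _))
  simpa only [Set.ncard_image_of_injective _ ConnectedComponent.supp_injective,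
    Set.ncard_singleton] using h

/-- A barrier of minimal size: each of its vertices is adjacent to at least three components. -/
theorem exists_barrier_three_le [Finite V] {D : ℕ} (hD : Even (Nat.card V + D))
    (h : ∃ S : Set V, 2 * S.ncard + D ≤ (G.isolate S).oddComponents.ncard) :
    ∃ S : Set V, 2 * S.ncard + D ≤ (G.isolate S).oddComponents.ncard ∧
      ∀ s ∈ S, 3 ≤ (G.adjacentComponents S s).ncard := by
  obtain ⟨S, hS⟩ := h
  induction hn : S.ncard generalizing S with
  | zero =>
    rw [Set.ncard_eq_zero] at hn
    exact ⟨S, hS, by simp [hn]⟩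
  | succ n ih =>
    by_cases h3 : ∀ s ∈ S, 3 ≤ (G.adjacentComponents S s).ncard
    · exact ⟨S, hS, h3⟩
    push Not at h3
    obtain ⟨s, hs, h3⟩ := h3
    have hcard := Set.ncard_sdiff_singleton_add_one hs
    refine ih (S \ {s}) ?_ (by omega)
    -- At most `1 + 2` odd components are lost while `2|S|` drops by 2. The resulting shortfall of
    -- at most 1 is ruled out by parity.
    have hle := ncard_oddComponents_isolate_le (G := G) hs
    have hpar := (G.isolate (S \ {s})).odd_ncard_oddComponents
    simp only [oddComponents] at *
    rw [Nat.even_iff] at hD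
    rw [Nat.odd_iff, Nat.odd_iff] at hpar
    omega

end SimpleGraph

/-! ### Barriers in graphs without induced `T_3` and `K_{1,d+1}`. -/

namespace FinGraph

theorem isIndContained_of_injective {V W : Type*} {H : SimpleGraph V} {G : SimpleGraph W}
    (f : V → W) (hf : Function.Injective f) (h : ∀ a b, G.Adj (f a) (f b) ↔ H.Adj a b) :
    H.IsIndContained G :=
  ⟨⟨⟨f, hf⟩, h _ _⟩⟩

theorem tee_isIndContained {V : Type*} {G : SimpleGraph V} {s a b y z : V}
    (hsa : G.Adj s a) (hab : G.Adj a b) (hsy : G.Adj s y) (hsz : G.Adj s z)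
    (hsb' : s ≠ b) (hyz' : y ≠ z) (hsb : ¬ G.Adj s b) (hay : ¬ G.Adj a y) (haz : ¬ G.Adj a z)
    (hby : ¬ G.Adj b y) (hbz : ¬ G.Adj b z) (hyz : ¬ G.Adj y z) :
    (tee 3).graph.IsIndContained G := by
  have h1 : a ≠ y := by rintro rfl; exact hby hab.symm
  have h2 : a ≠ z := by rintro rfl; exact hbz hab.symm
  have h3 : b ≠ y := by rintro rfl; exact hsb hsy
  have h4 : b ≠ z := by rintro rfl; exact hsb hsz
  refine isIndContained_of_injective (Sum.elim ![s, a, b] ![y, z]) ?_ ?_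
  · have := hsa.ne
    have := hab.ne
    have := hsy.ne
    have := hsz.ne
    rintro (i | i) (j | j) <;> fin_cases i <;> fin_cases j <;>
      first | (intro; rfl) | simp_all [eq_comm]
  · rintro (i | i) (j | j) <;> fin_cases i <;> fin_cases j <;>
      simp [tee, pathGraph_adj, *, hsa.symm, hab.symm, hsy.symm, hsz.symm, G.adj_comm b s,
        G.adj_comm y a, G.adj_comm z a, G.adj_comm y b, G.adj_comm z b, G.adj_comm z y]

theorem star_isIndContained {V : Type*} {G : SimpleGraph V} {n : ℕ} {s : V} {f : Fin n → V}
    (hf : Function.Injective f) (hs : ∀ i, G.Adj s (f i)) (hi : ∀ i j, ¬ G.Adj (f i) (f j)) :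
    (star n).graph.IsIndContained G := by
  refine isIndContained_of_injective (Sum.elim (fun _ => s) f) ?_ ?_
  · rintro (i | i) (j | j) h
    · rw [Subsingleton.elim i j]
    · exact absurd h (hs j).ne
    · exact absurd h.symm (hs i).ne
    · exact congrArg _ (hf h)
  · rintro (i | i) (j | j) <;> simp [star, hs, hi, (hs _).symm]

section Barrier

variable {V : Type*} {G : SimpleGraph V} {S : Set V}

theorem not_adj_of_mk_ne {x y : V} (hx : x ∉ S) (hy : y ∉ S)
    (h : (G.isolate S).connectedComponentMk x ≠ (G.isolate S).connectedComponentMk y) :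
    ¬ G.Adj x y :=
  fun hxy => h (mk_eq_of_adj hx hy hxy)

variable [Finite V]

theorem exists_two_of_two_le {s : V} {T : Set (G.isolate S).ConnectedComponent}
    (hT : T ⊆ G.adjacentComponents S s) (h : 2 ≤ T.ncard) :
    ∃ y z, y ∉ S ∧ z ∉ S ∧ G.Adj s y ∧ G.Adj s z ∧
      (G.isolate S).connectedComponentMk y ∈ T ∧ (G.isolate S).connectedComponentMk z ∈ T ∧
      (G.isolate S).connectedComponentMk y ≠ (G.isolate S).connectedComponentMk z := by
  obtain ⟨c₁, h₁, c₂, h₂, hne⟩ := (Set.one_lt_ncard (Set.toFinite _)).1 h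
  obtain ⟨y, hy, hsy, rfl⟩ := hT h₁
  obtain ⟨z, hz, hsz, rfl⟩ := hT h₂
  exact ⟨y, z, hy, hz, hsy, hsz, h₁, h₂, hne⟩

/-- A barrier vertex is complete to each component it touches. Otherwise some edge `ab` of the
component has `s` adjacent to `a` only, and neighbours of `s` in two further components complete an
induced `T_3` centred at `s`. -/
theorem adj_of_reachable_isolate (hG : ¬ (tee 3).graph.IsIndContained G) {s x y : V} (hs : s ∈ S)
    (h3 : 3 ≤ (G.adjacentComponents S s).ncard) (hsx : G.Adj s x)
    (hxy : (G.isolate S).Reachable x y) : G.Adj s y := by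
  rw [reachable_iff_reflTransGen] at hxy
  induction hxy with
  | refl => exact hsx
  | @tail a b _ hab hsa =>
    by_contra hsb
    obtain ⟨hadj, ha, hb⟩ := hab
    have h2 : 2 ≤ (G.adjacentComponents S s \ {(G.isolate S).connectedComponentMk a}).ncard := by
      have := Set.ncard_le_ncard_sdiff_add_ncard (G.adjacentComponents S s)
        {(G.isolate S).connectedComponentMk a}
      rw [Set.ncard_singleton] at this
      omega
    obtain ⟨y, z, hy, hz, hsy, hsz, hcy, hcz, hyz⟩ := exists_two_of_two_le Set.sdiff_subset h2
    have hya := Ne.symm hcy.2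
    have hza := Ne.symm hcz.2
    have hyb := hya
    have hzb := hza
    rw [mk_eq_of_adj ha hb hadj] at hyb hzb
    refine hG (tee_isIndContained hsa hadj hsy hsz ?_ ?_ hsb (not_adj_of_mk_ne ha hy hya)
      (not_adj_of_mk_ne ha hz hza) (not_adj_of_mk_ne hb hy hyb) (not_adj_of_mk_ne hb hz hzb)
      (not_adj_of_mk_ne hy hz hyz))
    · rintro rfl
      exact hb hs
    · rintro rfl
      exact hyz rfl

/-- If both alternatives fail, an induced `T_3` is centred at `t`, with leaves `y`, `z` in two
components missed by `s`. Its long arm is `t, s, w` with `w` in a component missed by `t` when `s`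
and `t` are adjacent, and `t, x, s` with `x` in a common component otherwise. -/
theorem ncard_diff_le_one_or_subset (hG : ¬ (tee 3).graph.IsIndContained G)
    (h3 : ∀ s ∈ S, 3 ≤ (G.adjacentComponents S s).ncard) {s t : V} (ht : t ∈ S)
    (hst : s ≠ t)
    (h : G.Adj s t ∨ (G.adjacentComponents S s ∩ G.adjacentComponents S t).Nonempty) :
    (G.adjacentComponents S t \ G.adjacentComponents S s).ncard ≤ 1 ∨
      G.adjacentComponents S s ⊆ G.adjacentComponents S t := by
  by_contra! hcon
  obtain ⟨hcard, hsub⟩ := hcon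
  obtain ⟨y, z, hy, hz, hty, htz, hcy, hcz, hyz⟩ := exists_two_of_two_le Set.sdiff_subset hcard
  have hsy : ¬ G.Adj s y := fun h => hcy.2 (mk_mem_adjacentComponents hy h)
  have hsz : ¬ G.Adj s z := fun h => hcz.2 (mk_mem_adjacentComponents hz h)
  have hyz' : y ≠ z := fun h => hyz (by rw [h])
  by_cases hadj : G.Adj s t
  · obtain ⟨c, hcs, hct⟩ := Set.not_subset.1 hsub
    obtain ⟨w, hw, hsw, rfl⟩ := hcs
    refine hG (tee_isIndContained hadj.symm hsw hty htz ?_ hyz'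
      (fun h => hct (mk_mem_adjacentComponents hw h)) hsy hsz ?_ ?_ (not_adj_of_mk_ne hy hz hyz))
    · rintro rfl
      exact hw ht
    · exact not_adj_of_mk_ne hw hy fun h => hcy.2 (h ▸ mk_mem_adjacentComponents hw hsw)
    · exact not_adj_of_mk_ne hw hz fun h => hcz.2 (h ▸ mk_mem_adjacentComponents hw hsw)
  · obtain ⟨c, ⟨x, hx, hsx, rfl⟩, ⟨x', hx', htx', hc⟩⟩ := h.resolve_left hadj
    have htx := adj_of_reachable_isolate hG ht (h3 t ht) htx' (ConnectedComponent.exact hc)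
    have hmem := mk_mem_adjacentComponents hx hsx
    exact hG (tee_isIndContained htx hsx.symm hty htz hst.symm hyz' (fun h => hadj h.symm)
      (not_adj_of_mk_ne hx hy fun h => hcy.2 (h ▸ hmem))
      (not_adj_of_mk_ne hx hz fun h => hcz.2 (h ▸ hmem)) hsy hsz (not_adj_of_mk_ne hy hz hyz))

theorem inter_adjacentComponents_nonempty (hG : ¬ (tee 3).graph.IsIndContained G)
    (h3 : ∀ s ∈ S, 3 ≤ (G.adjacentComponents S s).ncard) {s t : V} (hs : s ∈ S) (ht : t ∈ S)
    (hst : G.Adj s t) : (G.adjacentComponents S s ∩ G.adjacentComponents S t).Nonempty := by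
  have hs3 := h3 s hs
  have ht3 := h3 t ht
  by_contra hne
  rw [Set.not_nonempty_iff_eq_empty, ← Set.disjoint_iff_inter_eq_empty] at hne
  rcases ncard_diff_le_one_or_subset hG h3 ht hst.ne (Or.inl hst) with h | h
  · rw [hne.symm.sdiff_eq_left] at h
    omega
  · rw [hne.eq_bot_of_le h] at hs3
    simp at hs3

theorem ncard_adjacentComponents_le {d : ℕ} (hG : ¬ (star (d + 1)).graph.IsIndContained G) (s : V) :
    (G.adjacentComponents S s).ncard ≤ d := by
  by_contra! h
  obtain ⟨T, hT, hTcard⟩ := Set.exists_subset_card_eq (Nat.succ_le_of_lt h)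
  have hcard : Nat.card T = d + 1 := by rw [Nat.card_coe_set_eq, hTcard]
  let e := (Finite.equivFinOfCardEq hcard).symm
  choose f hfS hf hfe using fun i => hT (e i).2
  have hinj : ∀ i j, (G.isolate S).connectedComponentMk (f i) =
      (G.isolate S).connectedComponentMk (f j) → i = j := by
    intro i j hij
    rw [hfe, hfe] at hij
    exact e.injective (Subtype.ext hij)
  refine hG (star_isIndContained (f := f) (fun i j hij => hinj i j (by rw [hij])) hf ?_)
  intro i j hij
  have := hinj i j (mk_eq_of_adj (hfS i) (hfS j) hij)
  subst this
  exact hij.ne rfl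

/-- A walk in `G` from `s₀` is traced in the intersection graph. This yields both its connectedness
and the fact that every component of `G - S` is touched by some barrier vertex. -/
theorem exists_reachable_intersectionGraph (hconn : G.Connected)
    (hG : ¬ (tee 3).graph.IsIndContained G)
    (h3 : ∀ s ∈ S, 3 ≤ (G.adjacentComponents S s).ncard) (s₀ : S) (v : V) :
    ∃ s : S, (intersectionGraph fun s : S => G.adjacentComponents S s.1).Reachable s₀ s ∧
      (s = v ∨ v ∉ S ∧ (G.isolate S).connectedComponentMk v ∈ G.adjacentComponents S s.1) := by
  have hadj : ∀ s t : S, (G.adjacentComponents S s.1 ∩ G.adjacentComponents S t.1).Nonempty →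
      (intersectionGraph fun s : S => G.adjacentComponents S s.1).Reachable s t := by
    intro s t h
    by_cases hst : s = t
    · rw [hst]
    · exact Adj.reachable ⟨hst, h⟩
  have h := hconn.preconnected s₀.1 v
  rw [reachable_iff_reflTransGen] at h
  induction h with
  | refl => exact ⟨s₀, Reachable.refl _, Or.inl rfl⟩
  | @tail b c _ hbc ih =>
    obtain ⟨s, hs, rfl | ⟨hb, hbs⟩⟩ := ih
    · by_cases hc : c ∈ S
      · exact ⟨⟨c, hc⟩, hs.trans (hadj _ _ (inter_adjacentComponents_nonempty hG h3 s.2 hc hbc)),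
          Or.inl rfl⟩
      · exact ⟨s, hs, Or.inr ⟨hc, mk_mem_adjacentComponents hc hbc⟩⟩
    · by_cases hc : c ∈ S
      · exact ⟨⟨c, hc⟩, hs.trans (hadj _ _ ⟨_, hbs, mk_mem_adjacentComponents hb hbc.symm⟩),
          Or.inl rfl⟩
      · exact ⟨s, hs, Or.inr ⟨hc, mk_eq_of_adj hb hc hbc ▸ hbs⟩⟩

theorem ncard_oddComponents_isolate_lt {d : ℕ} (hd : 2 ≤ d) (hconn : G.Connected)
    (hstar : ¬ (star (d + 1)).graph.IsIndContained G) (hG : ¬ (tee 3).graph.IsIndContained G)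
    (h3 : ∀ s ∈ S, 3 ≤ (G.adjacentComponents S s).ncard) :
    (G.isolate S).oddComponents.ncard < 2 * S.ncard + d := by
  rcases S.eq_empty_or_nonempty with rfl | ⟨s₀, hs₀⟩
  · have : (G.isolate ∅).Preconnected := hconn.preconnected.mono fun a b h => ⟨h, id, id⟩
    have := this.subsingleton_connectedComponent
    have := Set.ncard_le_one_of_subsingleton (G.isolate ∅).oddComponents
    simp only [oddComponents, Set.ncard_empty] at *
    omega
  · let N : S → Set (G.isolate S).ConnectedComponent := fun s => G.adjacentComponents S s.1
    have hreach := exists_reachable_intersectionGraph hconn hG h3 ⟨s₀, hs₀⟩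
    have hL : (intersectionGraph N).Connected := by
      rw [connected_iff_exists_forall_reachable]
      refine ⟨⟨s₀, hs₀⟩, fun t => ?_⟩
      obtain ⟨s, hs, hst | ⟨ht, -⟩⟩ := hreach t.1
      · rwa [← Subtype.ext hst]
      · exact absurd t.2 ht
    have hle := ncard_iUnion_lt_of_intersectionGraph_connected hL
      (fun s t hst => ncard_diff_le_one_or_subset hG h3 t.2
        (fun h => hst.1 (Subtype.ext h)) (Or.inr hst.2))
      (fun s => ncard_adjacentComponents_le hstar s.1)
    have hsub : (G.isolate S).oddComponents ⊆
        (G.isolate S).connectedComponentMk '' S ∪ ⋃ s, N s := by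
      intro c _
      induction c using ConnectedComponent.ind with
      | h v =>
        obtain ⟨s, -, rfl | ⟨-, hv⟩⟩ := hreach v
        · exact Or.inl ⟨s, s.2, rfl⟩
        · exact Or.inr (Set.mem_iUnion.2 ⟨s, hv⟩)
    have h1 := (Set.ncard_le_ncard hsub).trans ((Set.ncard_union_le _ _).trans
      (Nat.add_le_add_right (Set.ncard_image_le (Set.toFinite _)) _))
    rw [Nat.card_coe_set_eq] at hle
    change (⋃ s, N s).ncard + 1 ≤ _ at hle
    omega

end Barrier

/-! ### Deficiency: the upper bound, and a lower bound from vertex covers. -/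

section Deficiency

variable (G : FinGraph)

theorem bddAbove_matchingSizes :
    BddAbove {k : ℕ | ∃ M : G.graph.Subgraph, M.IsMatching ∧ M.edgeSet.ncard = k} := by
  refine ⟨G.graph.edgeSet.ncard, ?_⟩
  rintro _ ⟨M, -, rfl⟩
  exact Set.ncard_le_ncard M.edgeSet_subset

theorem exists_isMatching_ncard_eq :
    ∃ M : G.graph.Subgraph, M.IsMatching ∧ M.edgeSet.ncard = G.matchingNumber :=
  Nat.sSup_mem (s := {k : ℕ | ∃ M : G.graph.Subgraph, M.IsMatching ∧ M.edgeSet.ncard = k})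
    ⟨_, ⊥, fun _ hv => hv.elim, rfl⟩ G.bddAbove_matchingSizes

variable {G}

theorem ncard_verts_le {M : G.graph.Subgraph} (hM : M.IsMatching) :
    M.verts.ncard ≤ 2 * G.matchingNumber := by
  have hle : M.edgeSet.ncard ≤ G.matchingNumber := le_csSup G.bddAbove_matchingSizes ⟨M, hM, rfl⟩
  have hsurj := Set.ncard_le_ncard hM.verts_eq_biUnion_edgeSet.le
  have h2 : (⋃ e ∈ M.edgeSet, (e : Set G.V)).ncard ≤ 2 * M.edgeSet.ncard := by
    classical
    cases nonempty_fintype G.V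
    have : (⋃ e ∈ M.edgeSet, (e : Set G.V)) =
        ((M.edgeSet.toFinset.biUnion Sym2.toFinset : Finset G.V) : Set G.V) := by
      ext v
      simp
    rw [this, Set.ncard_coe_finset, Set.ncard_eq_toFinset_card', mul_comm]
    refine Finset.card_biUnion_le_card_mul _ _ _ fun e _ => ?_
    induction e with
    | _ x y =>
      rw [Sym2.toFinset_mk_eq]
      exact Finset.card_le_two
  omega

/-- The deficiency is at least `|V| - 2 |S|` for every vertex cover `S`. -/
theorem le_deficiency_of_cover (S : Set G.V) (hS : ∀ a b, G.graph.Adj a b → a ∈ S ∨ b ∈ S) :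
    (Nat.card G.V : ℤ) - 2 * S.ncard ≤ G.deficiency := by
  obtain ⟨M, hM, hcard⟩ := G.exists_isMatching_ncard_eq
  have hx : ∀ e : M.edgeSet, ∃ s : S, s.1 ∈ e.1 := by
    rintro ⟨e, he⟩
    induction e with
    | _ a b =>
      rcases hS a b (M.adj_sub he) with h | h
      · exact ⟨⟨a, h⟩, Sym2.mem_mk_left _ _⟩
      · exact ⟨⟨b, h⟩, Sym2.mem_mk_right _ _⟩
  choose f hf using hx
  have hinj : Function.Injective f := by
    intro e e' hee
    have h1 := hf e
    have h2 := hf e'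
    rw [← hee] at h2
    have hv := M.mem_verts_of_mem_edge e.2 h1
    have h3 := hM.mem_coe_toEdge hv
    obtain ⟨a, ha⟩ := Sym2.mem_iff_exists.1 h1
    obtain ⟨b, hb⟩ := Sym2.mem_iff_exists.1 h2
    have hea := e.2
    have heb := e'.2
    rw [ha] at hea
    rw [hb] at heb
    have : a = b := hM.eq_of_adj_left hea heb
    exact Subtype.ext (by rw [ha, hb, this])
  have := Nat.card_le_card_of_injective f hinj
  rw [Nat.card_coe_set_eq, Nat.card_coe_set_eq, hcard] at this
  rw [deficiency]
  omega

theorem deficiency_lt_of_not_isIndContained {d : ℕ} (hd : 2 ≤ d) (hconn : G.graph.Connected)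
    (hstar : ¬ (star (d + 1)).graph.IsIndContained G.graph)
    (htee : ¬ (tee 3).graph.IsIndContained G.graph) : G.deficiency < d := by
  by_contra! hle
  rw [deficiency] at hle
  -- The deficiency is at least `d ≥ 2`, so it can be written `k + 2`; every matching then misses
  -- more than `k` vertices, as `exists_barrier` requires.
  obtain ⟨k, hk⟩ : ∃ k, Nat.card G.V = 2 * G.matchingNumber + k + 2 :=
    ⟨Nat.card G.V - 2 * G.matchingNumber - 2, by omega⟩
  have hbar := G.graph.exists_barrier k (by rw [hk]; exact ⟨G.matchingNumber + k + 1, by ring⟩)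
    fun M hM => by
      have := ncard_verts_le hM
      omega
  obtain ⟨S, hS, h3⟩ := exists_barrier_three_le (D := k + 2)
    (by rw [hk]; exact ⟨G.matchingNumber + k + 2, by ring⟩) hbar
  have := ncard_oddComponents_isolate_lt hd hconn hstar htee h3
  simp only [oddComponents] at *
  omega

end Deficiency

theorem Iso.refl (H : FinGraph) : H.Iso H := ⟨RelIso.refl _⟩

theorem Iso.symm {H K : FinGraph} (h : H.Iso K) : K.Iso H := h.map RelIso.symm

theorem Iso.trans {H K L : FinGraph} (h : H.Iso K) (h' : K.Iso L) : H.Iso L :=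
  h.elim fun e => h'.map e.trans

theorem Iso.isInducedIn {H K : FinGraph} (h : H.Iso K) : H.IsInducedIn K :=
  h.elim fun e => e.isIndContained

/-! ### Tools for transferring induced subgraphs. -/

section Embeddings

variable {U V W : Type*} {H : SimpleGraph U} {K : SimpleGraph V} {L : SimpleGraph W}

theorem nonempty_iso_of_isIndContained_of_card_le [Finite V] (h : H.IsIndContained K)
    (hcard : Nat.card V ≤ Nat.card U) : Nonempty (H ≃g K) := by
  obtain ⟨φ⟩ := h
  exact ⟨RelIso.ofSurjective φ (φ.injective.bijective_of_nat_card_le hcard).2⟩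

theorem isIndContained_of_embedding (φ : H ↪g K) (g : V → W)
    (hinj : ∀ x y, x ∈ Set.range φ → y ∈ Set.range φ → g x = g y → x = y)
    (hadj : ∀ x y, x ∈ Set.range φ → y ∈ Set.range φ → (L.Adj (g x) (g y) ↔ K.Adj x y)) :
    H.IsIndContained L :=
  isIndContained_of_injective (g ∘ φ)
    (fun a b hab => φ.injective (hinj _ _ ⟨a, rfl⟩ ⟨b, rfl⟩ hab))
    fun a b => (hadj _ _ ⟨a, rfl⟩ ⟨b, rfl⟩).trans φ.map_adj_iff

theorem isIndContained_of_subsingleton [Subsingleton U] (x : V) : H.IsIndContained K :=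
  isIndContained_of_injective (fun _ => x) (fun _ _ _ => Subsingleton.elim _ _) fun a b => by
    simp [Subsingleton.elim a b]

theorem exists_adj_mem_range (hH : H.Connected) [Nontrivial U] (φ : H ↪g K) {x : V}
    (hx : x ∈ Set.range φ) : ∃ y ∈ Set.range φ, K.Adj x y := by
  obtain ⟨h, rfl⟩ := hx
  obtain ⟨h', hadj⟩ := hH.preconnected.exists_adj_of_nontrivial h
  exact ⟨φ h', ⟨h', rfl⟩, φ.map_adj_iff.2 hadj⟩

theorem card_ne_add_one [Finite U] (c : U) : Nat.card {x // x ≠ c} + 1 = Nat.card U := by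
  have := Set.ncard_add_ncard_compl ({c} : Set U)
  rw [Set.ncard_singleton] at this
  have h3 : Nat.card {x // x ≠ c} = ({c}ᶜ : Set U).ncard := Nat.card_coe_set_eq _
  omega

end Embeddings

/-! ### Stars and their connected induced subgraphs. -/

section Stars

/-- The graph of `FinGraph.star`, on an explicit vertex type. -/
abbrev starOn (n : ℕ) : SimpleGraph (Fin 1 ⊕ Fin n) := completeBipartiteGraph (Fin 1) (Fin n)

theorem card_star (n : ℕ) : Nat.card (star n).V = n + 1 := by
  change Nat.card (Fin 1 ⊕ Fin n) = n + 1
  simp [add_comm]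

theorem star_isInducedIn_star {s t : ℕ} (h : s ≤ t) : (star s).IsInducedIn (star t) :=
  star_isIndContained (G := starOn t) (s := .inl 0) (f := fun i => .inr (Fin.castLE h i))
    (fun i j hij => by simpa using hij) (fun i => by simp) fun i j => by simp

theorem star_connected (s : ℕ) : (star s).graph.Connected := by
  change (starOn s).Connected
  rw [connected_iff_exists_forall_reachable]
  refine ⟨.inl 0, ?_⟩
  rintro (i | i)
  · rw [Subsingleton.elim i 0]
  · exact Adj.reachable (by simp)

theorem le_deficiency_star (d : ℕ) : (d : ℤ) ≤ (star (d + 1)).deficiency := by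
  have := le_deficiency_of_cover (G := star (d + 1)) (Set.range Sum.inl) (by
    rintro (a | a) (b | b) h
    · exact Or.inl ⟨a, rfl⟩
    · exact Or.inl ⟨a, rfl⟩
    · exact Or.inr ⟨b, rfl⟩
    · simp [star] at h)
  have hc : (Set.range (Sum.inl : Fin 1 → Fin 1 ⊕ Fin (d + 1))).ncard = 1 := by
    rw [← Set.image_univ, Set.ncard_image_of_injective _ Sum.inl_injective]
    simp
  change _ - 2 * (((Set.range (Sum.inl : Fin 1 → Fin 1 ⊕ Fin (d + 1))).ncard : ℕ) : ℤ) ≤ _ at this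
  rw [card_star, hc] at this
  push_cast at this
  omega

theorem isInducedIn_star_three_or_iso_star {H : FinGraph} (hH : H.graph.Connected) {n : ℕ}
    (h : H.IsInducedIn (star n)) : H.IsInducedIn (star 3) ∨ ∃ s ≤ n, H.Iso (star s) := by
  rcases subsingleton_or_nontrivial H.V with _ | _
  · exact Or.inl (isIndContained_of_subsingleton (.inl 0))
  right
  obtain ⟨φ⟩ : Nonempty (H.graph ↪g starOn n) := h
  obtain ⟨c, hc⟩ : ∃ c, φ c = .inl 0 := by
    obtain ⟨x⟩ := hH.nonempty
    obtain ⟨y, ⟨c, rfl⟩, hy⟩ := exists_adj_mem_range hH φ ⟨x, rfl⟩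
    rcases hx : φ x with v | v
    · exact ⟨x, by rw [hx, Subsingleton.elim v 0]⟩
    rcases hc : φ c with w | w
    · exact ⟨c, by rw [hc, Subsingleton.elim w 0]⟩
    · simp [hx, hc] at hy
  have hleaf : ∀ x, x ≠ c → ∃ i, φ x = .inr i := by
    intro x hx
    rcases h : φ x with v | v
    · rw [Subsingleton.elim v 0, ← hc] at h
      exact absurd (φ.injective h) hx
    · exact ⟨v, rfl⟩
  let e := (Finite.equivFin {x // x ≠ c}).symm
  have hcard := card_ne_add_one c
  have hle := Nat.card_le_card_of_injective φ φ.injective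
  change _ ≤ Nat.card (star n).V at hle
  rw [card_star] at hle
  refine ⟨Nat.card {x // x ≠ c}, by omega, Iso.symm (nonempty_iso_of_isIndContained_of_card_le
    (star_isIndContained (s := c) (f := fun i => (e i).1)
      (fun i j hij => e.injective (Subtype.ext hij)) (fun i => ?_) fun i j => ?_) ?_)⟩
  · obtain ⟨k, hk⟩ := hleaf _ (e i).2
    rw [← φ.map_adj_iff, hk, hc]
    simp
  · obtain ⟨k, hk⟩ := hleaf _ (e i).2
    obtain ⟨l, hl⟩ := hleaf _ (e j).2
    rw [← φ.map_adj_iff, hk, hl]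
    simp
  · rw [card_star, hcard]

end Stars

/-! ### `T_3` and its connected induced subgraphs. -/

section Tee

/-- The graph of `FinGraph.tee 3`, on an explicit vertex type. -/
def teeThree : SimpleGraph (Fin 3 ⊕ Fin 2) := (tee 3).graph

theorem teeThree_adj_inl_inl {i j : Fin 3} :
    teeThree.Adj (.inl i) (.inl j) ↔ i.val + 1 = j ∨ j.val + 1 = i := pathGraph_adj

theorem teeThree_adj_inl_inr {i : Fin 3} {j : Fin 2} :
    teeThree.Adj (.inl i) (.inr j) ↔ i.val = 0 := Iff.rfl

theorem teeThree_adj_inr_inl {i : Fin 2} {j : Fin 3} :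
    teeThree.Adj (.inr i) (.inl j) ↔ j.val = 0 := Iff.rfl

theorem teeThree_adj_inr_inr {i j : Fin 2} : ¬ teeThree.Adj (.inr i) (.inr j) := id

theorem star_three_isInducedIn_tee : (star 3).IsInducedIn (tee 3) :=
  star_isIndContained (G := teeThree) (s := .inl 0) (f := ![.inl 1, .inr 0, .inr 1])
    (by
      intro i j
      fin_cases i <;> fin_cases j <;> simp)
    (by
      intro i
      fin_cases i <;> simp [teeThree_adj_inl_inl, teeThree_adj_inl_inr])
    (by
      intro i j
      fin_cases i <;> fin_cases j <;> simp [teeThree_adj_inl_inr,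
        teeThree_adj_inr_inl, teeThree_adj_inr_inr])

theorem path_four_isInducedIn_tee : (path 4).IsInducedIn (tee 3) :=
  isIndContained_of_injective (H := pathGraph 4) (G := teeThree) ![.inr 0, .inl 0, .inl 1, .inl 2]
    (by
      intro i j
      fin_cases i <;> fin_cases j <;> simp)
    (by
      intro i j
      fin_cases i <;> fin_cases j <;> simp [pathGraph_adj, teeThree_adj_inl_inl,
        teeThree_adj_inl_inr, teeThree_adj_inr_inl])

theorem path_four_not_isInducedIn_star (n : ℕ) : ¬ (path 4).IsInducedIn (star n) := by
  intro h
  obtain ⟨φ⟩ : Nonempty (pathGraph 4 ↪g starOn n) := h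
  have hadj : ∀ i j : Fin 4, (starOn n).Adj (φ i) (φ j) ↔ i.val + 1 = j ∨ j.val + 1 = i :=
    fun i j => φ.map_adj_iff.trans pathGraph_adj
  have hinl : ∀ i j : Fin 4, (φ i).isLeft → (φ j).isLeft → i = j := by
    intro i j hi hj
    obtain ⟨a, ha⟩ := Sum.isLeft_iff.1 hi
    obtain ⟨b, hb⟩ := Sum.isLeft_iff.1 hj
    exact φ.injective (by rw [ha, hb, Subsingleton.elim a b])
  have hstep : ∀ i j : Fin 4, i.val + 1 = j → ((φ i).isLeft ↔ ¬ (φ j).isLeft) := by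
    intro i j hij
    have := (hadj i j).2 (Or.inl hij)
    revert this
    rcases φ i with a | a <;> rcases φ j with b | b <;> simp
  have h01 := hstep 0 1 (by decide)
  have h12 := hstep 1 2 (by decide)
  have h23 := hstep 2 3 (by decide)
  have h02 : ¬ ((φ 0).isLeft ∧ (φ 2).isLeft) := fun h => absurd (hinl 0 2 h.1 h.2) (by decide)
  have h13 : ¬ ((φ 1).isLeft ∧ (φ 3).isLeft) := fun h => absurd (hinl 1 3 h.1 h.2) (by decide)
  tauto

theorem tee_connected : (tee 3).graph.Connected := by
  change teeThree.Connected
  rw [connected_iff_exists_forall_reachable]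
  have h1 : teeThree.Adj (.inl 0) (.inl 1) := by simp [teeThree_adj_inl_inl]
  have h2 : teeThree.Adj (.inl 1) (.inl 2) := by simp [teeThree_adj_inl_inl]
  refine ⟨.inl 0, ?_⟩
  rintro (i | i)
  · fin_cases i
    · exact Reachable.refl _
    · exact h1.reachable
    · exact h1.reachable.trans h2.reachable
  · exact Adj.reachable rfl

theorem path_connected {n : ℕ} : (path (n + 1)).graph.Connected := pathGraph_connected n

theorem iso_tee_or_iso_path_or_isInducedIn_star {H : FinGraph} (hH : H.graph.Connected)
    (h : H.IsInducedIn (tee 3)) :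
    H.Iso (tee 3) ∨ H.Iso (path 4) ∨ H.IsInducedIn (star 3) := by
  rcases subsingleton_or_nontrivial H.V with _ | _
  · exact Or.inr (Or.inr (isIndContained_of_subsingleton (.inl 0)))
  obtain ⟨φ⟩ : Nonempty (H.graph ↪g teeThree) := h
  have hnbr := fun x => exists_adj_mem_range hH φ (x := x)
  by_cases h0 : ∃ i, Sum.inr i ∈ Set.range φ
  swap
  · right; right
    refine isIndContained_of_embedding (L := starOn 3) φ
      (Sum.elim ![.inr 0, .inl 0, .inr 1] fun _ => .inl 0) ?_ ?_
    · rintro (i | i) (j | j) hi hj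
      · fin_cases i <;> fin_cases j <;> simp
      · exact absurd ⟨j, hj⟩ h0
      · exact absurd ⟨i, hi⟩ h0
      · exact absurd ⟨i, hi⟩ h0
    · rintro (i | i) (j | j) hi hj
      · fin_cases i <;> fin_cases j <;> simp [teeThree_adj_inl_inl]
      · exact absurd ⟨j, hj⟩ h0
      · exact absurd ⟨i, hi⟩ h0
      · exact absurd ⟨i, hi⟩ h0
  by_cases h2 : Sum.inl 2 ∈ Set.range φ
  swap
  · right; right
    refine isIndContained_of_embedding (L := starOn 3) φ
      (Sum.elim ![.inl 0, .inr 0, .inl 0] ![.inr 1, .inr 2]) ?_ ?_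
    · rintro (i | i) (j | j) hi hj <;> fin_cases i <;> fin_cases j <;>
        first | exact absurd hi h2 | exact absurd hj h2 | simp
    · rintro (i | i) (j | j) hi hj <;> fin_cases i <;> fin_cases j <;>
        first
        | exact absurd hi h2
        | exact absurd hj h2
        | simp [teeThree_adj_inl_inl, teeThree_adj_inl_inr, teeThree_adj_inr_inl,
            teeThree_adj_inr_inr]
  obtain ⟨i₀, h0⟩ := h0
  have hc : Sum.inl 0 ∈ Set.range φ := by
    obtain ⟨y | y, hy, hadj⟩ := hnbr _ h0
    · have : y = 0 := Fin.ext hadj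
      rwa [this] at hy
    · exact (teeThree_adj_inr_inr hadj).elim
  have h1 : Sum.inl 1 ∈ Set.range φ := by
    obtain ⟨y | y, hy, hadj⟩ := hnbr _ h2
    · rw [teeThree_adj_inl_inl] at hadj
      have : y = 1 := by
        ext
        simp at hadj ⊢
        omega
      rwa [this] at hy
    · simp [teeThree_adj_inl_inr] at hadj
  by_cases hall : ∀ i, Sum.inr i ∈ Set.range φ
  · left
    refine ⟨RelIso.ofSurjective φ ?_⟩
    rintro (i | i)
    · fin_cases i
      exacts [hc, h1, h2]
    · exact hall i
  · right; left
    push Not at hall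
    obtain ⟨i₁, hi₁⟩ := hall
    have hinr : ∀ i, Sum.inr i ∈ Set.range φ → i = i₀ := by
      intro i hi
      have h' : i ≠ i₁ := by rintro rfl; exact hi₁ hi
      have h'' : i₀ ≠ i₁ := by rintro rfl; exact hi₁ h0
      omega
    refine nonempty_iso_of_isIndContained_of_card_le (K := pathGraph 4)
      (isIndContained_of_embedding φ (Sum.elim ![1, 2, 3] fun _ => 0) ?_ ?_) ?_
    · rintro (i | i) (j | j) hi hj
      · fin_cases i <;> fin_cases j <;> simp
      · fin_cases i <;> simp
      · fin_cases j <;> simp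
      · simp [hinr i hi, hinr j hj]
    · rintro (i | i) (j | j) hi hj
      · fin_cases i <;> fin_cases j <;> simp [pathGraph_adj, teeThree_adj_inl_inl]
      · fin_cases i <;> simp [pathGraph_adj, teeThree_adj_inl_inr]
      · fin_cases j <;> simp [pathGraph_adj, teeThree_adj_inr_inl]
      · simp [teeThree_adj_inr_inr]
    · obtain ⟨a, ha⟩ := hc
      obtain ⟨b, hb⟩ := h1
      obtain ⟨e, he⟩ := h2
      obtain ⟨f, hf⟩ := h0
      have hinj : Function.Injective (φ ∘ ![a, b, e, f]) := by
        intro i j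
        fin_cases i <;> fin_cases j <;> simp [ha, hb, he, hf]
      have := Nat.card_le_card_of_injective _ hinj.of_comp
      simpa using this

end Tee

/-! ### Two extremal graphs without induced `K_{1,4}`. -/

section Examples

variable (d : ℕ)

/-- A caterpillar: the centres `(i, 0)` have a pendant vertex `(i, 2)`, and consecutive centres are
at distance two, joined through the vertices `(i, 1)`. -/
def caterpillarGraph : SimpleGraph (Fin d × Fin 3) :=
  fromRel fun x y => x.2 = 0 ∧
    (y.2 = 1 ∧ (y.1 = x.1 ∨ y.1.val = x.1.val + 1) ∨ y.2 = 2 ∧ y.1 = x.1)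

/-- A clique on the vertices `(i, 0)`, each of which has two pendant vertices `(i, 1)`, `(i, 2)`. -/
def pendantCliqueGraph : SimpleGraph (Fin d × Fin 3) :=
  fromRel fun x y => x.2 = 0 ∧ (y.2 = 0 ∨ y.1 = x.1)

/-- The bundled `caterpillarGraph`. -/
def caterpillar : FinGraph where
  V := Fin d × Fin 3
  graph := caterpillarGraph d

/-- The bundled `pendantCliqueGraph`. -/
def pendantClique : FinGraph where
  V := Fin d × Fin 3
  graph := pendantCliqueGraph d

variable {d}

theorem caterpillarGraph_adj_center {i : Fin d} {y : Fin d × Fin 3} :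
    (caterpillarGraph d).Adj (i, 0) y ↔
      y.2 = 1 ∧ (y.1 = i ∨ y.1.val = i.val + 1) ∨ y.2 = 2 ∧ y.1 = i := by
  obtain ⟨j, k⟩ := y
  fin_cases k <;> simp [caterpillarGraph, fromRel_adj]

theorem caterpillarGraph_adj_snd {x y : Fin d × Fin 3} (h : (caterpillarGraph d).Adj x y) :
    x.2 = 0 ∧ y.2 ≠ 0 ∨ x.2 ≠ 0 ∧ y.2 = 0 := by
  obtain ⟨-, ⟨hx, ⟨hy, -⟩ | ⟨hy, -⟩⟩ | ⟨hy, ⟨hx, -⟩ | ⟨hx, -⟩⟩⟩ := h <;> simp [hx, hy]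

theorem caterpillarGraph_adj_leaf {x y : Fin d × Fin 3} (hx : x.2 ≠ 0)
    (h : (caterpillarGraph d).Adj x y) :
    y.2 = 0 ∧ (y.1 = x.1 ∨ x.1.val = y.1.val + 1) := by
  obtain ⟨-, ⟨hx', -⟩ | ⟨hy, h⟩⟩ := h
  · exact absurd hx' hx
  · refine ⟨hy, ?_⟩
    rcases h with ⟨-, h | h⟩ | ⟨-, h⟩
    exacts [Or.inl h.symm, Or.inr h, Or.inl h.symm]

theorem pendantCliqueGraph_adj_center {i : Fin d} {y : Fin d × Fin 3} :
    (pendantCliqueGraph d).Adj (i, 0) y ↔ y.2 = 0 ∧ y.1 ≠ i ∨ y.2 ≠ 0 ∧ y.1 = i := by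
  obtain ⟨j, k⟩ := y
  fin_cases k <;> simp [pendantCliqueGraph, fromRel_adj, eq_comm]

theorem pendantCliqueGraph_adj_leaf {x y : Fin d × Fin 3} (hx : x.2 ≠ 0) :
    (pendantCliqueGraph d).Adj x y ↔ y = (x.1, 0) := by
  obtain ⟨j, k⟩ := y
  obtain ⟨i, l⟩ := x
  fin_cases k <;> fin_cases l <;> simp [pendantCliqueGraph, fromRel_adj, eq_comm] at hx ⊢

theorem caterpillar_connected (hd : 0 < d) : (caterpillar d).graph.Connected := by
  change (caterpillarGraph d).Connected
  rw [connected_iff_exists_forall_reachable]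
  have hc : ∀ n, (hn : n < d) → (caterpillarGraph d).Reachable (⟨0, hd⟩, 0) (⟨n, hn⟩, 0) := by
    intro n
    induction n with
    | zero => exact fun _ => Reachable.refl _
    | succ n ih =>
      intro hn
      refine (ih (by omega)).trans ((Adj.reachable (v := (⟨n + 1, hn⟩, 1)) ?_).trans
        (Adj.reachable ?_))
      · simp [caterpillarGraph_adj_center]
      · rw [adj_comm]
        simp [caterpillarGraph_adj_center]
  refine ⟨(⟨0, hd⟩, 0), fun ⟨i, k⟩ => ?_⟩
  refine (hc i.1 i.2).trans ?_
  fin_cases k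
  · exact Reachable.refl _
  all_goals exact Adj.reachable (by simp [caterpillarGraph_adj_center])

theorem pendantClique_connected (hd : 0 < d) : (pendantClique d).graph.Connected := by
  change (pendantCliqueGraph d).Connected
  rw [connected_iff_exists_forall_reachable]
  refine ⟨(⟨0, hd⟩, 0), fun ⟨i, k⟩ => ?_⟩
  have hc : (pendantCliqueGraph d).Reachable (⟨0, hd⟩, 0) (i, 0) := by
    by_cases hi : i = ⟨0, hd⟩
    · rw [hi]
    · exact Adj.reachable (by simp [pendantCliqueGraph_adj_center, hi])
  refine hc.trans ?_
  by_cases hk : k = 0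
  · rw [hk]
  · exact Adj.reachable (by simp [pendantCliqueGraph_adj_center, hk])

theorem ncard_centers : {x : Fin d × Fin 3 | x.2 = 0}.ncard = d := by
  have : {x : Fin d × Fin 3 | x.2 = 0} = (fun i => (i, 0)) '' (Set.univ : Set (Fin d)) := by
    ext ⟨i, k⟩
    simp [eq_comm]
  rw [this, Set.ncard_image_of_injective _ fun i j h => (Prod.mk.inj h).1]
  simp

/-- The `d` centres cover all edges of a graph on `3d` vertices, so the deficiency is at least `3d -
2d`. -/
theorem le_deficiency_of_centers {G : SimpleGraph (Fin d × Fin 3)}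
    (hG : ∀ a b, G.Adj a b → a.2 = 0 ∨ b.2 = 0) : (d : ℤ) ≤ deficiency ⟨Fin d × Fin 3, G⟩ := by
  have := le_deficiency_of_cover (G := ⟨Fin d × Fin 3, G⟩) {x : Fin d × Fin 3 | x.2 = 0} hG
  rw [ncard_centers, Nat.card_prod, Nat.card_fin, Nat.card_fin] at this
  push_cast at this
  linarith

theorem le_deficiency_caterpillar : (d : ℤ) ≤ (caterpillar d).deficiency :=
  le_deficiency_of_centers fun _ _ h => (caterpillarGraph_adj_snd h).imp And.left And.right

theorem le_deficiency_pendantClique : (d : ℤ) ≤ (pendantClique d).deficiency :=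
  le_deficiency_of_centers fun _ _ h => h.2.imp And.left And.left

/-- If the neighbours of every vertex can be coloured with three colours such that any two
neighbours of the same colour are equal or adjacent, then there is no induced `K_{1,4}`. -/
theorem star_four_not_isIndContained {V : Type*} {G : SimpleGraph V} (f : V → V → Fin 3)
    (hf : ∀ c x y, G.Adj c x → G.Adj c y → f c x = f c y → x = y ∨ G.Adj x y) :
    ¬ (star 4).graph.IsIndContained G := by
  intro h
  obtain ⟨φ⟩ : Nonempty (starOn 4 ↪g G) := h
  obtain ⟨i, j, hij, hfij⟩ := Fintype.exists_ne_map_eq_of_card_lt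
    (fun i : Fin 4 => f (φ (.inl 0)) (φ (.inr i))) (by simp)
  have hadj : ∀ i, G.Adj (φ (.inl 0)) (φ (.inr i)) := fun i => φ.map_adj_iff.2 (by simp)
  rcases hf _ _ _ (hadj i) (hadj j) hfij with h | h
  · exact hij (Sum.inr_injective (φ.injective h))
  · simpa using φ.map_adj_iff.1 h

theorem star_four_not_isInducedIn_caterpillar : ¬ (star 4).IsInducedIn (caterpillar d) := by
  refine star_four_not_isIndContained (G := caterpillarGraph d)
    (fun c y => if y.2 = 2 then 2 else if y.1 = c.1 then 1 else 0) ?_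
  intro c x y hx hy hxy
  left
  by_cases hc : c.2 = 0
  · have hc' : c = (c.1, 0) := Prod.ext rfl hc
    rw [hc', caterpillarGraph_adj_center] at hx hy
    rcases hx with ⟨hx2, hx1 | hx1⟩ | ⟨hx2, hx1⟩ <;> rcases hy with ⟨hy2, hy1 | hy1⟩ | ⟨hy2, hy1⟩ <;>
      simp [hx1, hx2, hy1, hy2, Prod.ext_iff, Fin.ext_iff] at hxy ⊢
  · obtain ⟨hx2, hx1⟩ := caterpillarGraph_adj_leaf hc hx
    obtain ⟨hy2, hy1⟩ := caterpillarGraph_adj_leaf hc hy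
    rcases hx1 with hx1 | hx1 <;> rcases hy1 with hy1 | hy1 <;>
      simp [hx1, hx2, hy1, hy2, Prod.ext_iff, Fin.ext_iff] at hxy ⊢
    omega

theorem star_four_not_isInducedIn_pendantClique : ¬ (star 4).IsInducedIn (pendantClique d) := by
  refine star_four_not_isIndContained (G := pendantCliqueGraph d) (fun _ y => y.2) ?_
  intro c x y hx hy hxy
  by_cases hc : c.2 = 0
  · have hc' : c = (c.1, 0) := Prod.ext rfl hc
    rw [hc', pendantCliqueGraph_adj_center] at hx hy
    by_cases hx0 : x.2 = 0
    · by_cases h : x = y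
      · exact Or.inl h
      · exact Or.inr ⟨h, Or.inl ⟨hx0, Or.inl (hxy ▸ hx0)⟩⟩
    · left
      have hy0 : y.2 ≠ 0 := fun h => hx0 (hxy.trans h)
      simp only [hx0, hy0, ne_eq, not_false_eq_true, false_and, true_and, false_or] at hx hy
      exact Prod.ext (hx.trans hy.symm) hxy
  · rw [pendantCliqueGraph_adj_leaf hc] at hx hy
    exact Or.inl (hx.trans hy.symm)

theorem caterpillarGraph_triangle_free {x y z : Fin d × Fin 3} (hxy : (caterpillarGraph d).Adj x y)
    (hyz : (caterpillarGraph d).Adj y z) (hxz : (caterpillarGraph d).Adj x z) : False := by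
  have h1 := caterpillarGraph_adj_snd hxy
  have h2 := caterpillarGraph_adj_snd hyz
  have h3 := caterpillarGraph_adj_snd hxz
  tauto

theorem caterpillarGraph_leaf_adj_three {x p q r : Fin d × Fin 3} (hx : x.2 ≠ 0)
    (hp : (caterpillarGraph d).Adj x p) (hq : (caterpillarGraph d).Adj x q)
    (hr : (caterpillarGraph d).Adj x r) : p = q ∨ p = r ∨ q = r := by
  obtain ⟨hp2, hp1⟩ := caterpillarGraph_adj_leaf hx hp
  obtain ⟨hq2, hq1⟩ := caterpillarGraph_adj_leaf hx hq
  obtain ⟨hr2, hr1⟩ := caterpillarGraph_adj_leaf hx hr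
  simp only [Prod.ext_iff, Fin.ext_iff, hp2, hq2, hr2, and_true] at hp1 hq1 hr1 ⊢
  omega

theorem caterpillarGraph_not_adj_of_three {x y p q r s : Fin d × Fin 3}
    (hxy : (caterpillarGraph d).Adj x y) (hp : (caterpillarGraph d).Adj x p)
    (hq : (caterpillarGraph d).Adj x q) (hr : (caterpillarGraph d).Adj y r)
    (hs : (caterpillarGraph d).Adj y s) (hpq : p ≠ q) (hpy : p ≠ y) (hqy : q ≠ y) (hrs : r ≠ s)
    (hrx : r ≠ x) (hsx : s ≠ x) : False := by
  rcases caterpillarGraph_adj_snd hxy with ⟨-, hy⟩ | ⟨hx, -⟩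
  · have := caterpillarGraph_leaf_adj_three hy hr hs hxy.symm
    tauto
  · have := caterpillarGraph_leaf_adj_three hx hp hq hxy
    tauto

theorem isInducedIn_tee_of_missing_pendant {H : FinGraph} (φ : H.graph ↪g pendantCliqueGraph d)
    {i j : Fin d} (hij : i ≠ j) (hφ : ∀ x ∈ Set.range φ, x.1 = i ∨ x.1 = j) {k : Fin 3}
    (hk : k ≠ 0) (hjk : (j, k) ∉ Set.range φ) : H.IsInducedIn (tee 3) := by
  let g : Fin d × Fin 3 → Fin 3 ⊕ Fin 2 := fun x =>
    -- Both pendants at `j` go to the end of the long arm; injectivity survives because at most one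
    -- of them is present.
    if x.1 = i then ![.inl 0, .inr 0, .inr 1] x.2 else ![.inl 1, .inl 2, .inl 2] x.2
  have hx : ∀ x ∈ Set.range φ, x = (i, 0) ∨ x = (i, 1) ∨ x = (i, 2) ∨ x = (j, 0) ∨
      ∃ l, l ≠ 0 ∧ l ≠ k ∧ x = (j, l) := by
    rintro ⟨a, l⟩ h
    rcases hφ _ h with rfl | rfl
    · fin_cases l <;> simp
    · by_cases hl : l = 0
      · simp [hl]
      · exact Or.inr (Or.inr (Or.inr (Or.inr ⟨l, hl, fun h' => hjk (h' ▸ h), rfl⟩)))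
  have hgj : ∀ l, l ≠ 0 → g (j, l) = .inl 2 := by
    intro l hl
    fin_cases l <;> simp [g, hij.symm] at hl ⊢
  have hg0 : g (i, 0) = .inl 0 := by simp [g]
  have hg1 : g (i, 1) = .inr 0 := by simp [g]
  have hg2 : g (i, 2) = .inr 1 := by simp [g]
  have hg3 : g (j, 0) = .inl 1 := by simp [g, hij.symm]
  refine isIndContained_of_embedding (L := teeThree) φ g ?_ ?_
  · intro x y hxr hyr
    rcases hx x hxr with rfl | rfl | rfl | rfl | ⟨l, hl, hlk, rfl⟩ <;>
      rcases hx y hyr with rfl | rfl | rfl | rfl | ⟨m, hm, hmk, rfl⟩ <;>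
      simp [*]
    omega
  · intro x y hxr hyr
    rcases hx x hxr with rfl | rfl | rfl | rfl | ⟨l, hl, hlk, rfl⟩ <;>
      rcases hx y hyr with rfl | rfl | rfl | rfl | ⟨m, hm, hmk, rfl⟩ <;>
      simp [pendantCliqueGraph_adj_center, pendantCliqueGraph_adj_leaf,
        teeThree_adj_inl_inl, teeThree_adj_inl_inr, teeThree_adj_inr_inl, teeThree_adj_inr_inr,
        hij.symm, *]

/-- The caterpillar is triangle-free, so `H` uses at most two centres of the clique. If all four
pendants at those centres occurred, `H` would have two adjacent vertices of degree 3, but in the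
caterpillar one end of every edge has degree at most 2. So a pendant is missing, and what remains
lies in `T_3`. -/
theorem isInducedIn_tee {H : FinGraph} (hd : 2 ≤ d) (hH : H.graph.Connected)
    (hA : H.IsInducedIn (caterpillar d)) (hB : H.IsInducedIn (pendantClique d)) :
    H.IsInducedIn (tee 3) := by
  rcases subsingleton_or_nontrivial H.V with _ | _
  · exact isIndContained_of_subsingleton (.inl 0)
  obtain ⟨ψ⟩ : Nonempty (H.graph ↪g caterpillarGraph d) := hA
  obtain ⟨φ⟩ : Nonempty (H.graph ↪g pendantCliqueGraph d) := hB
  have hcenter : ∀ x ∈ Set.range φ, (x.1, 0) ∈ Set.range φ := by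
    intro x hx
    by_cases hx0 : x.2 = 0
    · rwa [← hx0]
    · obtain ⟨y, hy, hadj⟩ := exists_adj_mem_range hH φ hx
      rw [pendantCliqueGraph_adj_leaf hx0] at hadj
      rwa [← hadj]
  have hψ : ∀ a b, (pendantCliqueGraph d).Adj (φ a) (φ b) → (caterpillarGraph d).Adj (ψ a) (ψ b) :=
    fun a b h => ψ.map_adj_iff.2 (φ.map_adj_iff.1 h)
  have hthree : ∀ x ∈ Set.range φ, ∀ y ∈ Set.range φ, ∀ z ∈ Set.range φ,
      x.1 = y.1 ∨ x.1 = z.1 ∨ y.1 = z.1 := by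
    intro x hx y hy z hz
    by_contra! hne
    obtain ⟨a, ha⟩ := hcenter x hx
    obtain ⟨b, hb⟩ := hcenter y hy
    obtain ⟨c, hc⟩ := hcenter z hz
    refine caterpillarGraph_triangle_free (hψ a b ?_) (hψ b c ?_) (hψ a c ?_) <;>
      simp [ha, hb, hc, pendantCliqueGraph_adj_center, hne.1.symm, hne.2.1.symm, hne.2.2.symm]
  obtain ⟨i, j, hij, hrange⟩ : ∃ i j, i ≠ j ∧ ∀ x ∈ Set.range φ, x.1 = i ∨ x.1 = j := by
    obtain ⟨h⟩ := hH.nonempty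
    by_cases hall : ∀ x ∈ Set.range φ, x.1 = (φ h).1
    · have : Nontrivial (Fin d) := Fin.nontrivial_iff_two_le.2 hd
      obtain ⟨j, hj⟩ := exists_ne (φ h).1
      exact ⟨_, j, hj.symm, fun x hx => Or.inl (hall x hx)⟩
    · push Not at hall
      obtain ⟨y, hy, hne⟩ := hall
      refine ⟨_, _, hne.symm, fun x hx => ?_⟩
      rcases hthree x hx y hy (φ h) ⟨h, rfl⟩ with h | h | h
      exacts [Or.inr h, Or.inl h, absurd h hne]
  by_cases hj : ∃ k, k ≠ 0 ∧ (j, k) ∉ Set.range φ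
  · obtain ⟨k, hk, hjk⟩ := hj
    exact isInducedIn_tee_of_missing_pendant φ hij hrange hk hjk
  by_cases hi : ∃ k, k ≠ 0 ∧ (i, k) ∉ Set.range φ
  · obtain ⟨k, hk, hik⟩ := hi
    exact isInducedIn_tee_of_missing_pendant φ hij.symm (fun x hx => (hrange x hx).symm) hk hik
  push Not at hi hj
  exfalso
  obtain ⟨p, hp⟩ := hi 1 (by decide)
  obtain ⟨q, hq⟩ := hi 2 (by decide)
  obtain ⟨r, hr⟩ := hj 1 (by decide)
  obtain ⟨s, hs⟩ := hj 2 (by decide)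
  obtain ⟨x, hx⟩ := hcenter _ (hi 1 (by decide))
  obtain ⟨y, hy⟩ := hcenter _ (hj 1 (by decide))
  have hne : ∀ a b, φ a ≠ φ b → ψ a ≠ ψ b := fun a b h h' => h (congrArg φ (ψ.injective h'))
  refine caterpillarGraph_not_adj_of_three (hψ x y ?_) (hψ x p ?_) (hψ x q ?_) (hψ y r ?_)
    (hψ y s ?_) (hne p q ?_) (hne p y ?_) (hne q y ?_) (hne r s ?_) (hne r x ?_) (hne s x ?_) <;>
    simp [hp, hq, hr, hs, hx, hy, pendantCliqueGraph_adj_center, hij.symm]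

end Examples

/-! ### Minimal families. -/

theorem boundsDeficiency_of_isInducedIn {d s : ℕ} (hd : 2 ≤ d) (hs : s ≤ d + 1)
    {𝓗 : Set FinGraph} (hconn : ∀ H ∈ 𝓗, H.graph.Connected)
    (hstar : ∃ H ∈ 𝓗, H.IsInducedIn (star s)) (htee : ∃ H ∈ 𝓗, H.IsInducedIn (tee 3)) :
    BoundsDeficiency d 𝓗 := by
  obtain ⟨H, hH, hHs⟩ := hstar
  obtain ⟨K, hK, hKt⟩ := htee
  refine ⟨hconn, fun G hG hfree => deficiency_lt_of_not_isIndContained hd hG ?_ ?_⟩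
  · intro h
    refine hfree H hH (hHs.trans (SimpleGraph.IsIndContained.trans ?_ h))
    exact star_isInducedIn_star hs
  · exact fun h => hfree K hK (hKt.trans h)

theorem not_boundsDeficiency_of_star_free {d : ℕ} {𝓗 : Set FinGraph}
    (h : IsFree 𝓗 (star (d + 1))) : ¬ BoundsDeficiency d 𝓗 :=
  fun hb => (hb.2 _ (star_connected _) h).not_ge (le_deficiency_star d)

theorem not_boundsDeficiency_of_caterpillar_free {d : ℕ} (hd : 0 < d) {𝓗 : Set FinGraph}
    (h : IsFree 𝓗 (caterpillar d)) : ¬ BoundsDeficiency d 𝓗 :=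
  fun hb => (hb.2 _ (caterpillar_connected hd) h).not_ge le_deficiency_caterpillar

theorem not_boundsDeficiency_of_pendantClique_free {d : ℕ} (hd : 0 < d) {𝓗 : Set FinGraph}
    (h : IsFree 𝓗 (pendantClique d)) : ¬ BoundsDeficiency d 𝓗 :=
  fun hb => (hb.2 _ (pendantClique_connected hd) h).not_ge le_deficiency_pendantClique

theorem minimallyBoundsDeficiency_pair {d s : ℕ} (hd : 3 ≤ d) (hs : 4 ≤ s) (hsd : s ≤ d + 1)
    {H₁ H₂ : FinGraph} (h₁ : H₁.Iso (star s)) (h₂ : H₂.Iso (tee 3) ∨ H₂.Iso (path 4)) :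
    MinimallyBoundsDeficiency d {H₁, H₂} := by
  have h₂tee : H₂.IsInducedIn (tee 3) := by
    rcases h₂ with h | h
    · exact h.isInducedIn
    · exact h.isInducedIn.trans path_four_isInducedIn_tee
  have h₂path : (path 4).IsInducedIn H₂ := by
    rcases h₂ with h | h
    · exact path_four_isInducedIn_tee.trans h.symm.isInducedIn
    · exact h.symm.isInducedIn
  have hconn₁ : H₁.graph.Connected := h₁.elim fun e => e.connected_iff.2 (star_connected s)
  have hconn₂ : H₂.graph.Connected := by
    rcases h₂ with ⟨⟨e⟩⟩ | ⟨⟨e⟩⟩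
    · exact e.connected_iff.2 tee_connected
    · exact e.connected_iff.2 path_connected
  refine ⟨boundsDeficiency_of_isInducedIn (by omega) hsd ?_ ⟨H₁, Or.inl rfl, h₁.isInducedIn⟩
    ⟨H₂, Or.inr rfl, h₂tee⟩, ?_⟩
  · rintro H (rfl | rfl)
    exacts [hconn₁, hconn₂]
  intro 𝓗 hss
  -- Without the star, `K_{1,d+1}` is a counterexample since it has no induced `P_4`; without `H₂`,
  -- the caterpillar is one since it has no induced `K_{1,4}`.
  obtain ⟨K, hK, hK𝓗⟩ := Set.exists_of_ssubset hss
  rcases hK with rfl | rfl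
  · refine not_boundsDeficiency_of_star_free fun H hH hind => ?_
    rcases hss.1 hH with rfl | rfl
    · exact hK𝓗 hH
    · exact path_four_not_isInducedIn_star _ (h₂path.trans hind)
  · refine not_boundsDeficiency_of_caterpillar_free (by omega) fun H hH hind => ?_
    rcases hss.1 hH with rfl | rfl
    · exact star_four_not_isInducedIn_caterpillar
        ((star_isInducedIn_star hs).trans (h₁.symm.isInducedIn.trans hind))
    · exact hK𝓗 hH

theorem iso_of_minimallyBoundsDeficiency_pair {d : ℕ} (hd : 3 ≤ d) {H₁ H₂ : FinGraph}
    (hne : ¬ H₁.Iso H₂) (h : MinimallyBoundsDeficiency d {H₁, H₂})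
    (h₁ : H₁.IsInducedIn (star (d + 1))) :
    ∃ s, 4 ≤ s ∧ s ≤ d + 1 ∧ H₁.Iso (star s) ∧ (H₂.Iso (tee 3) ∨ H₂.Iso (path 4)) := by
  have hne' : H₁ ≠ H₂ := fun h => hne (h ▸ Iso.refl _)
  have hconn₁ := h.1.1 H₁ (Or.inl rfl)
  have hconn₂ := h.1.1 H₂ (Or.inr rfl)
  -- A member inside `K_{1,3}` also lies inside `T_3`, so it would bound the deficiency alone,
  -- against minimality.
  have hclaw : ∀ H, H.graph.Connected → ({H} : Set FinGraph) ⊂ {H₁, H₂} →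
      ¬ H.IsInducedIn (star 3) := by
    intro H hH hss hind
    refine h.2 _ hss (boundsDeficiency_of_isInducedIn (s := 3) (by omega) (by omega) ?_
      ⟨H, rfl, hind⟩ ⟨H, rfl, hind.trans star_three_isInducedIn_tee⟩)
    rintro _ rfl
    exact hH
  have hclaw₁ : ¬ H₁.IsInducedIn (star 3) := hclaw H₁ hconn₁
    ⟨by simp, fun hsub => hne' (hsub (Or.inr rfl : H₂ ∈ ({H₁, H₂} : Set FinGraph))).symm⟩
  have hclaw₂ : ¬ H₂.IsInducedIn (star 3) := hclaw H₂ hconn₂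
    ⟨by simp, fun hsub => hne' (hsub (Or.inl rfl : H₁ ∈ ({H₁, H₂} : Set FinGraph)))⟩
  obtain ⟨s, hsd, hs⟩ := (isInducedIn_star_three_or_iso_star hconn₁ h₁).resolve_left hclaw₁
  have hs4 : 4 ≤ s := by
    by_contra hlt
    exact hclaw₁ (hs.isInducedIn.trans (star_isInducedIn_star (by omega)))
  have h4 : (star 4).IsInducedIn H₁ := (star_isInducedIn_star hs4).trans hs.symm.isInducedIn
  have hcat : H₂.IsInducedIn (caterpillar d) := by
    by_contra hcon
    refine not_boundsDeficiency_of_caterpillar_free (by omega) ?_ h.1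
    rintro H (rfl | rfl) hind
    · exact star_four_not_isInducedIn_caterpillar (h4.trans hind)
    · exact hcon hind
  have hclq : H₂.IsInducedIn (pendantClique d) := by
    by_contra hcon
    refine not_boundsDeficiency_of_pendantClique_free (by omega) ?_ h.1
    rintro H (rfl | rfl) hind
    · exact star_four_not_isInducedIn_pendantClique (h4.trans hind)
    · exact hcon hind
  refine ⟨s, hs4, hsd, hs, ?_⟩
  have := iso_tee_or_iso_path_or_isInducedIn_star hconn₂
    (isInducedIn_tee (by omega) hconn₂ hcat hclq)
  tauto

theorem sameFamily_pair_iff {H₁ H₂ K₁ K₂ : FinGraph} (hne : ¬ H₁.Iso H₂) :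
    SameFamily {H₁, H₂} {K₁, K₂} ↔ H₁.Iso K₁ ∧ H₂.Iso K₂ ∨ H₂.Iso K₁ ∧ H₁.Iso K₂ := by
  constructor
  · rintro ⟨h, -⟩
    obtain ⟨A, hA, h1⟩ := h H₁ (Or.inl rfl)
    obtain ⟨B, hB, h2⟩ := h H₂ (Or.inr rfl)
    rcases hA with rfl | rfl <;> rcases hB with rfl | rfl
    · exact absurd (h1.trans h2.symm) hne
    · exact Or.inl ⟨h1, h2⟩
    · exact Or.inr ⟨h2, h1⟩
    · exact absurd (h1.trans h2.symm) hne
  · rintro (⟨h1, h2⟩ | ⟨h1, h2⟩)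
    · refine ⟨?_, ?_⟩
      · rintro _ (rfl | rfl)
        exacts [⟨_, Or.inl rfl, h1⟩, ⟨_, Or.inr rfl, h2⟩]
      · rintro _ (rfl | rfl)
        exacts [⟨_, Or.inl rfl, h1⟩, ⟨_, Or.inr rfl, h2⟩]
    · refine ⟨?_, ?_⟩
      · rintro _ (rfl | rfl)
        exacts [⟨_, Or.inr rfl, h2⟩, ⟨_, Or.inl rfl, h1⟩]
      · rintro _ (rfl | rfl)
        exacts [⟨_, Or.inr rfl, h1⟩, ⟨_, Or.inl rfl, h2⟩]

end FinGraph

theorem theorem5 (d : ℕ) (hd : 3 ≤ d) (H₁ H₂ : FinGraph) (hne : ¬ H₁.Iso H₂) :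
    FinGraph.MinimallyBoundsDeficiency d {H₁, H₂} ↔
      ∃ s : ℕ, 4 ≤ s ∧ s ≤ d + 1 ∧
        (FinGraph.SameFamily {H₁, H₂} {FinGraph.star s, FinGraph.tee 3} ∨
          FinGraph.SameFamily {H₁, H₂} {FinGraph.star s, FinGraph.path 4}) := by
  simp only [FinGraph.sameFamily_pair_iff hne]
  constructor
  · intro h
    have hstar : ∃ H ∈ ({H₁, H₂} : Set FinGraph), H.IsInducedIn (FinGraph.star (d + 1)) := by
      by_contra! hcon
      exact FinGraph.not_boundsDeficiency_of_star_free hcon h.1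
    obtain ⟨H, rfl | rfl, hH⟩ := hstar
    · obtain ⟨s, hs, hsd, h1, h2⟩ := FinGraph.iso_of_minimallyBoundsDeficiency_pair hd hne h hH
      exact ⟨s, hs, hsd, by tauto⟩
    · rw [Set.pair_comm] at h
      obtain ⟨s, hs, hsd, h1, h2⟩ := FinGraph.iso_of_minimallyBoundsDeficiency_pair hd
        (fun h' => hne h'.symm) h hH
      exact ⟨s, hs, hsd, by tauto⟩
  · rintro ⟨s, hs, hsd, h⟩
    have : (H₁.Iso (FinGraph.star s) ∧ (H₂.Iso (FinGraph.tee 3) ∨ H₂.Iso (FinGraph.path 4))) ∨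
        (H₂.Iso (FinGraph.star s) ∧ (H₁.Iso (FinGraph.tee 3) ∨ H₁.Iso (FinGraph.path 4))) := by
      tauto
    rcases this with ⟨h1, h2⟩ | ⟨h1, h2⟩
    · exact FinGraph.minimallyBoundsDeficiency_pair hd hs hsd h1 h2
    · rw [Set.pair_comm]
      exact FinGraph.minimallyBoundsDeficiency_pair hd hs hsd h1 h2
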